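/- Let $s\ge 1$, let $l_1,\dots,l_s\ge 1$ and $t_1>t_2>\dots>t_s\ge 1$ be integers, and let $G=K_{l_1*t_1,\dots,l_s*t_s}$ be the complete multipartite graph which has, for each $i$, exactly $l_i$ parts with $t_i$ vertices each (two vertices are adjacent if and only if they lie in different parts). Assume that $G$ is isomorphic neither to $K_2$ nor to $K_4\setminus\{e\}$, the complete graph on four vertices with one edge removed. Regard $G$ as a signed graph in which all edges are positive; for a set $X$ of vertices of $G$, let $G^{\sigma}$ be the signed graph obtained from $G$ by switching about $X$, that is, by reversing the signs of all edges between $X$ and $V(G)\setminus X$. Let $A(G^{\sigma})$ be its adjacency matrix, whose $(u,v)$ entry is the sign of the edge $uv$ if $u$ and $v$ are adjacent, and $0$ otherwise. Then there is a set $X\subseteq V(G)$ such that every eigenvalue of $A(G^{\sigma})$ is main, i.e. has an eigenvector the sum of whose entries is not zero. -/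

import Mathlib

/-- A signed graph: an underlying simple graph together with a sign `+1` or `-1` on each edge. -/
structure SignedGraph (V : Type*) where
  graph : SimpleGraph V
  sign : graph.edgeSet → ℤˣ

namespace SignedGraph

/-- A graph regarded as a signed graph in which all edges are positive. -/
def ofGraph {V : Type*} (G : SimpleGraph V) : SignedGraph V where
  graph := G
  sign := fun _ => 1

open Classical in
/-- The switching of `Γ` about `X`: the signs of exactly the edges between `X` and its
complement are reversed. -/
noncomputable def switch {V : Type*} (Γ : SignedGraph V) (X : Set V) : SignedGraph V where
  graph := Γ.graph
  sign := fun e =>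
    if ∃ u ∈ X, ∃ v ∉ X, (e : Sym2 V) = s(u, v) then -Γ.sign e else Γ.sign e

open Classical in
/-- The adjacency matrix: the entry at `(u, v)` is the sign of the edge `uv`,
and `0` if `u` and `v` are not adjacent. -/
noncomputable def adjMatrix {V : Type*} (Γ : SignedGraph V) : Matrix V V ℝ :=
  Matrix.of fun u v =>
    if h : Γ.graph.Adj u v then
      (((Γ.sign ⟨s(u, v), Γ.graph.mem_edgeSet.mpr h⟩ : ℤˣ) : ℤ) : ℝ)
    else 0

/-- `μ` is an eigenvalue of the signed graph, that is, of its adjacency matrix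
(which is real symmetric, so all its eigenvalues are real). -/
def IsEigenvalue {V : Type*} [Fintype V] [DecidableEq V] (Γ : SignedGraph V) (μ : ℝ) : Prop :=
  Module.End.HasEigenvalue (Matrix.toLin' Γ.adjMatrix) μ

/-- `μ` is a main eigenvalue: it has an eigenvector whose entries do not sum to zero. -/
def IsMainEigenvalue {V : Type*} [Fintype V] [DecidableEq V] (Γ : SignedGraph V) (μ : ℝ) : Prop :=
  ∃ x : V → ℝ, Module.End.HasEigenvector (Matrix.toLin' Γ.adjMatrix) μ x ∧ ∑ v, x v ≠ 0

end SignedGraph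

/-- Vertices of `K_{l₁*t₁,…,lₛ*tₛ}`: the parts are indexed by the pairs `⟨i, j⟩` with
`j : Fin (l i)`, and the part `⟨i, j⟩` has `t i` vertices. -/
abbrev MultipartiteVertex {s : ℕ} (l t : Fin s → ℕ) : Type :=
  Σ p : (Σ i : Fin s, Fin (l i)), Fin (t p.1)

/-- The complete multipartite graph `K_{l₁*t₁,…,lₛ*tₛ}`, with `l i` parts of size `t i`. -/
abbrev multipartiteGraph {s : ℕ} (l t : Fin s → ℕ) : SimpleGraph (MultipartiteVertex l t) :=
  SimpleGraph.completeMultipartiteGraph fun p : (Σ i : Fin s, Fin (l i)) => Fin (t p.1)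

/-- The graph obtained from the complete graph on four vertices by deleting one edge. -/
def completeFourMinusEdge : SimpleGraph (Fin 4) :=
  (⊤ : SimpleGraph (Fin 4)).deleteEdges {s(0, 1)}

/-!
Let `d` be the `±1` vector of a set `X`, and `D` its diagonal matrix. Switching about `X` conjugates
the adjacency matrix `A` by `D`, so the switched graph has only main eigenvalues exactly when `d` is
orthogonal to no eigenspace of `A`. For a complete multipartite graph with at least two parts these
eigenspaces are explicit (`isMainEigenvalue_of_isEigenvalue`). With `b p` the sum of `d` over the
part `p`, the requirement on `d` becomes:

* for the eigenvalue `0`, if it occurs: `d` is not constant on some part;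
* for the eigenvalue `-t i`, if there are several parts of size `t i`: `b` is not constant on them;
* for every other eigenvalue `x`, whose eigenvector is `1 / (x + t i)` on the parts of size `t i`:
  `∑ B i / (x + t i) ≠ 0`, where `B i` is the sum of `d` over all parts of size `t i`.

Parity forces `B i ≡ l i * t i` modulo `2`. If some `l i * t i` is odd, take `B i = 0` for the even
classes and `B i = ±1` with alternating signs for the odd ones: such a sum has no real zero at all
(`exists_sign_sum_div_ne_zero`). If all `l i * t i` are even, a single class with `B i = 2` does the
same. The numbers of negative vertices per part that realise these sums and the first two conditions
come from `exists_counts_sum_small` and `exists_counts_sum_two`. They exist except when every class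
has `(l i, t i)` equal to `(2, 1)` or `(1, 2)`, which leaves `K₂`, `K₄ - e` and an edgeless graph,
and when `(l 0, t 0) = (2, 2)` while some `l i * t i` is odd. In that last case the graph is
`K_{2,2,1,…,1}`, and the sums `2` and `-1` give a function whose only zero is `0`, which is not one
of the eigenvalues `x` in question.
-/

/-! ### Eigenspaces of a switched complete multipartite graph -/

open Classical in
/-- The `±1` vector of a switching set: `-1` on `X` and `1` off `X`. -/
noncomputable def switchingSign {V : Type*} (X : Set V) (v : V) : ℝ :=
  if v ∈ X then -1 else 1

theorem switchingSign_mul_self {V : Type*} (X : Set V) (v : V) :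
    switchingSign X v * switchingSign X v = 1 := by
  unfold switchingSign
  split_ifs <;> norm_num

open Classical in
theorem adjMatrix_switch_ofGraph {V : Type*} (G : SimpleGraph V) (X : Set V) (u v : V) :
    ((SignedGraph.ofGraph G).switch X).adjMatrix u v =
      if G.Adj u v then switchingSign X u * switchingSign X v else 0 := by
  have key : (∃ a ∈ X, ∃ b ∉ X, s(u, v) = s(a, b)) ↔ ¬(u ∈ X ↔ v ∈ X) := by
    constructor
    · rintro ⟨a, ha, b, hb, h⟩
      rcases Sym2.eq_iff.1 h with ⟨rfl, rfl⟩ | ⟨rfl, rfl⟩ <;> tauto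
    · intro h
      by_cases hu : u ∈ X
      · exact ⟨u, hu, v, by tauto, rfl⟩
      · exact ⟨v, by tauto, u, hu, Sym2.eq_swap⟩
  by_cases h : G.Adj u v
  · have h' : ((SignedGraph.ofGraph G).switch X).graph.Adj u v := h
    simp only [SignedGraph.adjMatrix, Matrix.of_apply, h, h', dif_pos, if_true]
    simp only [SignedGraph.switch, SignedGraph.ofGraph, key, switchingSign]
    by_cases hu : u ∈ X <;> by_cases hv : v ∈ X <;> simp [hu, hv]
  · have h' : ¬ ((SignedGraph.ofGraph G).switch X).graph.Adj u v := h
    simp [SignedGraph.adjMatrix, h, h']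

section Multipartite

variable {ι : Type*} [Fintype ι] [DecidableEq ι] {t : ι → ℕ}

/-- Conjugating by the sign vector turns the adjacency matrix of the switched complete multipartite
graph into the operator `y ↦ (∑ y) - (sum of y over the part)`. -/
theorem adjMatrix_switch_mulVec (X : Set (Σ p, Fin (t p))) (y : (Σ p, Fin (t p)) → ℝ)
    (v : Σ p, Fin (t p)) :
    Matrix.mulVec ((SignedGraph.ofGraph (SimpleGraph.completeMultipartiteGraph
      fun p => Fin (t p))).switch X).adjMatrix (fun u => switchingSign X u * y u) v =
      switchingSign X v * (∑ u, y u - ∑ k, y ⟨v.1, k⟩) := by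
  classical
  have h1 : ∑ u, y u - ∑ k, y ⟨v.1, k⟩ = ∑ u, if v.1 ≠ u.1 then y u else 0 := by
    have h2 : ∑ k, y ⟨v.1, k⟩ = ∑ u : (Σ p, Fin (t p)), if v.1 ≠ u.1 then 0 else y u := by
      rw [Fintype.sum_sigma, Finset.sum_eq_single v.1]
      · simp
      · intro p _ hp
        simp [hp.symm]
      · simp
    rw [h2, sub_eq_iff_eq_add, ← Finset.sum_add_distrib]
    refine Finset.sum_congr rfl fun u _ => ?_
    split_ifs <;> simp
  rw [h1, Finset.mul_sum, Matrix.mulVec, dotProduct]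
  refine Finset.sum_congr rfl fun u _ => ?_
  rw [adjMatrix_switch_ofGraph]
  simp only [SimpleGraph.comap_adj, SimpleGraph.top_adj]
  split_ifs
  · linear_combination switchingSign X v * y u * switchingSign_mul_self X u
  · simp

theorem exists_of_isEigenvalue_switch {X : Set (Σ p, Fin (t p))} {μ : ℝ}
    (h : ((SignedGraph.ofGraph (SimpleGraph.completeMultipartiteGraph
      fun p => Fin (t p))).switch X).IsEigenvalue μ) :
    ∃ y : (Σ p, Fin (t p)) → ℝ, y ≠ 0 ∧ ∀ v, ∑ u, y u - ∑ k, y ⟨v.1, k⟩ = μ * y v := by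
  obtain ⟨x, hx⟩ := h.exists_hasEigenvector
  have hxy : (fun u => switchingSign X u * (switchingSign X u * x u)) = x := by
    funext u
    rw [← mul_assoc, switchingSign_mul_self, one_mul]
  refine ⟨fun u => switchingSign X u * x u, ?_, fun v => ?_⟩
  · intro h0
    apply hx.2
    rw [← hxy]
    funext u
    simp [congrFun h0 u]
  · have h1 := adjMatrix_switch_mulVec X (fun u => switchingSign X u * x u) v
    rw [hxy] at h1
    have h2 := congrFun hx.apply_eq_smul v
    rw [Matrix.toLin'_apply, h1, Pi.smul_apply, smul_eq_mul] at h2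
    linear_combination switchingSign X v * h2 -
      (∑ u, switchingSign X u * x u - ∑ k, switchingSign X ⟨v.1, k⟩ * x ⟨v.1, k⟩) *
        switchingSign_mul_self X v

theorem isMainEigenvalue_switch {X : Set (Σ p, Fin (t p))} {μ : ℝ} {y : (Σ p, Fin (t p)) → ℝ}
    (hy : ∀ v, ∑ u, y u - ∑ k, y ⟨v.1, k⟩ = μ * y v)
    (hsum : ∑ v, switchingSign X v * y v ≠ 0) :
    ((SignedGraph.ofGraph (SimpleGraph.completeMultipartiteGraph
      fun p => Fin (t p))).switch X).IsMainEigenvalue μ := by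
  refine ⟨fun u => switchingSign X u * y u, ?_, hsum⟩
  rw [Module.End.hasEigenvector_iff, Module.End.mem_eigenspace_iff]
  refine ⟨?_, fun h0 => hsum (Finset.sum_eq_zero fun v _ => congrFun h0 v)⟩
  funext v
  rw [Matrix.toLin'_apply, adjMatrix_switch_mulVec, hy, Pi.smul_apply, smul_eq_mul]
  ring

/-- A switching makes all eigenvalues main as soon as its sign vector, with sum `b p` over the
part `p`, is orthogonal to none of the eigenspaces of the complete multipartite graph. -/
theorem isMainEigenvalue_of_isEigenvalue {X : Set (Σ p, Fin (t p))} (ht : ∀ p, 1 ≤ t p)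
    (hι : 2 ≤ Fintype.card ι) (b : ι → ℝ)
    (hb : ∀ p, ∑ k : Fin (t p), switchingSign X ⟨p, k⟩ = b p)
    (hzero : (∃ p, 2 ≤ t p) →
      ∃ p, ∃ k k' : Fin (t p), switchingSign X ⟨p, k⟩ ≠ switchingSign X ⟨p, k'⟩)
    (hneg : ∀ p q, p ≠ q → t p = t q → ∃ p' q', t p' = t p ∧ t q' = t p ∧ b p' ≠ b q')
    (hmain : ∀ x : ℝ, x ≠ 0 → (∀ p, x + t p ≠ 0) → ∑ p, b p / (x + t p) ≠ 0) {μ : ℝ}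
    (h : ((SignedGraph.ofGraph (SimpleGraph.completeMultipartiteGraph
      fun p => Fin (t p))).switch X).IsEigenvalue μ) :
    ((SignedGraph.ofGraph (SimpleGraph.completeMultipartiteGraph
      fun p => Fin (t p))).switch X).IsMainEigenvalue μ := by
  classical
  obtain ⟨y, hy0, hy⟩ := exists_of_isEigenvalue_switch h
  by_cases hμ : μ = 0
  · subst hμ
    have hpart : ∀ p, ∑ k, y ⟨p, k⟩ = ∑ u, y u := by
      intro p
      have := hy ⟨p, ⟨0, ht p⟩⟩
      simp only at this
      linarith
    have hS : ∑ u, y u = 0 := by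
      have h1 : ∑ u, y u = Fintype.card ι * ∑ u, y u := by
        conv_lhs => rw [Fintype.sum_sigma]
        rw [Finset.sum_congr rfl fun p _ => hpart p]
        simp
      have h2 : (2 : ℝ) ≤ Fintype.card ι := by exact_mod_cast hι
      have h3 : ((Fintype.card ι : ℝ) - 1) * ∑ u, y u = 0 := by linarith
      rcases mul_eq_zero.1 h3 with h3 | h3
      · linarith
      · exact h3
    have hbig : ∃ p, 2 ≤ t p := by
      by_contra! hsmall
      apply hy0
      funext ⟨p, k⟩
      have h1 := hpart p
      have : Subsingleton (Fin (t p)) := Fin.subsingleton_iff_le_one.2 (by have := hsmall p; omega)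
      rw [Fintype.sum_subsingleton _ k] at h1
      rw [h1, hS]
      rfl
    obtain ⟨p, k, k', hk⟩ := hzero hbig
    have hkk : k ≠ k' := fun h => hk (by rw [h])
    -- The null vector supported on two vertices of one part with different signs.
    have hsum : ∀ q, ∑ m : Fin (t q), ((if (⟨q, m⟩ : Σ p, Fin (t p)) = ⟨p, k⟩ then (1 : ℝ) else 0) -
        if (⟨q, m⟩ : Σ p, Fin (t p)) = ⟨p, k'⟩ then 1 else 0) = 0 := by
      intro q
      by_cases hq : q = p
      · subst hq
        simp
      · simp [hq]
    refine isMainEigenvalue_switch (y := fun v => (if v = ⟨p, k⟩ then 1 else 0) -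
      if v = ⟨p, k'⟩ then 1 else 0) ?_ ?_
    · intro v
      rw [hsum, Fintype.sum_sigma, Finset.sum_eq_zero fun q _ => hsum q]
      simp
    · simp only [mul_sub, mul_ite, mul_one, mul_zero, Finset.sum_sub_distrib, Finset.sum_ite_eq',
        Finset.mem_univ, if_true]
      exact sub_ne_zero.2 hk
  -- For `μ ≠ 0` an eigenvector is constant on parts.
  have hconst : ∃ c : ι → ℝ, y = fun v => c v.1 := by
    refine ⟨fun p => (∑ u, y u - ∑ k, y ⟨p, k⟩) / μ, funext fun v => ?_⟩
    rw [eq_div_iff hμ, hy v, mul_comm]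
  obtain ⟨c, rfl⟩ := hconst
  have hc : ∀ p, ∑ q, t q * c q = (μ + t p) * c p := by
    intro p
    have := hy ⟨p, ⟨0, ht p⟩⟩
    rw [Fintype.sum_sigma] at this
    simp only [Finset.sum_const, Finset.card_univ, Fintype.card_fin, nsmul_eq_mul] at this
    linarith
  have hd : ∀ e : ι → ℝ, ∑ v : Σ p, Fin (t p), switchingSign X v * e v.1 = ∑ p, b p * e p := by
    intro e
    rw [Fintype.sum_sigma]
    refine Finset.sum_congr rfl fun p _ => ?_
    rw [← hb, Finset.sum_mul]
  by_cases hq : ∃ q, μ + t q = 0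
  · obtain ⟨q, hq⟩ := hq
    have hS : ∑ q, t q * c q = 0 := by rw [hc q, hq, zero_mul]
    have hoff : ∀ p, t p ≠ t q → c p = 0 := by
      intro p hp
      have h1 := hc p
      rw [hS] at h1
      rcases mul_eq_zero.1 h1.symm with h1 | h1
      · exact absurd (by exact_mod_cast (by linarith : (t p : ℝ) = t q)) hp
      · exact h1
    obtain ⟨p, hp⟩ : ∃ p, c p ≠ 0 := by
      by_contra! h0
      exact hy0 (funext fun v => h0 v.1)
    have htp : t p = t q := by
      by_contra h0
      exact hp (hoff p h0)
    obtain ⟨r, hr, htr⟩ : ∃ r, r ≠ p ∧ t r = t q := by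
      by_contra! h0
      rw [Finset.sum_eq_single p (fun r _ hr => by rw [hoff r (h0 r hr), mul_zero])
        (by simp)] at hS
      rcases mul_eq_zero.1 hS with h1 | h1
      · have := ht p
        norm_cast at h1
        omega
      · exact hp h1
    obtain ⟨p', q', hp', hq', hne⟩ := hneg p r hr.symm (htp.trans htr.symm)
    set e : ι → ℝ := fun r => (if r = p' then 1 else 0) - if r = q' then 1 else 0 with he
    refine isMainEigenvalue_switch (y := fun v => e v.1) ?_ ?_
    · intro v
      rw [Fintype.sum_sigma]
      simp only [Finset.sum_const, Finset.card_univ, Fintype.card_fin, nsmul_eq_mul]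
      have h1 : ∑ r, (t r : ℝ) * e r = 0 := by
        simp [he, mul_sub, Finset.sum_sub_distrib, hp', hq']
      rw [h1]
      have h2 : (μ + t v.1) * e v.1 = 0 := by
        by_cases h3 : t v.1 = t p
        · rw [h3, htp, hq, zero_mul]
        · have h4 : v.1 ≠ p' := fun h => h3 (h ▸ hp')
          have h5 : v.1 ≠ q' := fun h => h3 (h ▸ hq')
          simp [he, h4, h5]
      linarith
    · rw [hd]
      simp only [he, mul_sub, mul_ite, mul_one, mul_zero, Finset.sum_sub_distrib,
        Finset.sum_ite_eq', Finset.mem_univ, if_true]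
      exact sub_ne_zero.2 hne
  · push Not at hq
    refine isMainEigenvalue_switch hy ?_
    rw [hd]
    have hcS : ∀ p, c p = (∑ q, t q * c q) / (μ + t p) := by
      intro p
      rw [eq_div_iff (hq p), hc p, mul_comm]
    have hS : ∑ q, t q * c q ≠ 0 := by
      intro h0
      refine hy0 (funext fun v => ?_)
      simp only [hcS v.1, h0, zero_div, Pi.zero_apply]
    have h1 : ∑ p, b p * c p = (∑ q, t q * c q) * ∑ p, b p / (μ + t p) := by
      rw [Finset.mul_sum]
      refine Finset.sum_congr rfl fun p _ => ?_
      conv_lhs => rw [hcS p]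
      ring
    rw [h1]
    exact mul_ne_zero hS (hmain μ hμ hq)

end Multipartite

/-! ### Alternating sums of simple fractions, and sums of signs over equal parts -/

/-- Signs alternating along `O` make `∑ ε i / (x + t i)` nonvanishing on the whole real line: the
terms left and right of `x` each form an alternating sum whose sign is that of the pole closest
to `x`, and the two signs agree. -/
theorem exists_sign_sum_div_ne_zero {ι : Type*} [LinearOrder ι] {t : ι → ℝ}
    (ht : StrictAnti t) (O : Finset ι) (hO : O.Nonempty) :
    ∃ ε : ι → ℤ, (∀ i, ε i = 1 ∨ ε i = -1) ∧
      ∀ x : ℝ, (∀ i ∈ O, x + t i ≠ 0) → ∑ i ∈ O, (ε i : ℝ) / (x + t i) ≠ 0 := by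
  classical
  -- Normalise the sign at the maximum `m` to be `1`. Then adding a new maximum `a` replaces the
  -- sum `R` by `1 / (x + t a) - R`, which preserves the bounds below.
  suffices h : ∃ ε : ι → ℤ, (∀ i, ε i = 1 ∨ ε i = -1) ∧
      ∀ x : ℝ, (∀ i ∈ O, x + t i ≠ 0) → ∀ m ∈ O, (∀ i ∈ O, i ≤ m) →
        (0 < x + t m → 0 < ∑ i ∈ O, (ε i : ℝ) / (x + t i) ∧
          ∑ i ∈ O, (ε i : ℝ) / (x + t i) ≤ 1 / (x + t m)) ∧
        (x + t m < 0 → ∑ i ∈ O, (ε i : ℝ) / (x + t i) ≤ 1 / (x + t m) ∨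
          0 < ∑ i ∈ O, (ε i : ℝ) / (x + t i)) by
    obtain ⟨ε, hε, h⟩ := h
    refine ⟨ε, hε, fun x hx => ?_⟩
    obtain ⟨h1, h2⟩ := h x hx (O.max' hO) (O.max'_mem hO) fun i hi => O.le_max' i hi
    rcases lt_or_gt_of_ne (hx _ (O.max'_mem hO)) with hm | hm
    · have := one_div_neg.2 hm
      rcases h2 hm with h3 | h3
      · linarith
      · exact h3.ne'
    · exact (h1 hm).1.ne'
  clear hO
  induction O using Finset.induction_on_max with
  | empty => exact ⟨fun _ => 1, by simp, by simp⟩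
  | insert a S ha ih =>
    obtain ⟨ε, hε, h⟩ := ih
    have haS : a ∉ S := fun h => lt_irrefl a (ha a h)
    refine ⟨Function.update (-ε) a 1, fun i => ?_, fun x hx m hm hmax => ?_⟩
    · by_cases hi : i = a
      · simp [hi]
      · have := hε i
        simp only [Function.update_of_ne hi, Pi.neg_apply]
        omega
    obtain rfl : m = a := by
      refine le_antisymm ?_ (hmax a (Finset.mem_insert_self a S))
      rcases Finset.mem_insert.1 hm with h1 | h1
      · exact h1.le
      · exact (ha m h1).le
    have hsum : ∑ i ∈ insert m S, ((Function.update (-ε) m 1 i : ℤ) : ℝ) / (x + t i) =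
        1 / (x + t m) - ∑ i ∈ S, (ε i : ℝ) / (x + t i) := by
      rw [Finset.sum_insert haS, sub_eq_add_neg, ← Finset.sum_neg_distrib]
      congr 1
      · simp
      · refine Finset.sum_congr rfl fun i hi => ?_
        rw [Function.update_of_ne (ne_of_mem_of_not_mem hi haS)]
        push_cast [Pi.neg_apply]
        ring
    rw [hsum]
    rcases S.eq_empty_or_nonempty with rfl | hS
    · simp
    · have hlt : x + t m < x + t (S.max' hS) := by
        have := ht (ha _ (S.max'_mem hS))
        linarith
      obtain ⟨h1, h2⟩ := h x (fun i hi => hx i (Finset.mem_insert_of_mem hi)) (S.max' hS)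
        (S.max'_mem hS) fun i hi => S.le_max' i hi
      refine ⟨fun h0 => ?_, fun h0 => ?_⟩
      · have h3 := one_div_lt_one_div_of_lt h0 hlt
        have h4 := h1 (h0.trans hlt)
        constructor <;> linarith
      · rcases lt_or_gt_of_ne (hx _ (Finset.mem_insert_of_mem (S.max'_mem hS))) with h3 | h3
        · have h4 := one_div_lt_one_div_of_neg_of_lt h3 hlt
          rcases h2 h3 with h5 | h5
          · right; linarith
          · left; linarith
        · have := h1 h3
          left; linarith

theorem sum_range_alternating (a b : ℤ) (l : ℕ) :
    ∑ j ∈ Finset.range l, (if Even j then a else b) =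
      (l / 2 : ℕ) * (a + b) + if Even l then 0 else a := by
  induction l with
  | zero => simp
  | succ l ih =>
    rw [Finset.sum_range_succ, ih]
    rcases Nat.even_or_odd' l with ⟨k, rfl | rfl⟩
    · have h1 : (2 * k + 1) / 2 = k := by omega
      simp [h1]
    · have h1 : (2 * k + 1) / 2 = k := by omega
      have h2 : (2 * k + 1 + 1) / 2 = k + 1 := by omega
      simp [h1, h2, Nat.even_add_one]
      ring

/-- Numbers `n j` of negative vertices in the `l` parts of size `t` for which the signs have total
`0`, or the given `e = ±1` if `l * t` is odd. -/
theorem exists_counts_sum_small {l t : ℕ} (hl : 1 ≤ l) (ht : 1 ≤ t) {e : ℤ}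
    (he : e = 1 ∨ e = -1) :
    ∃ n : ℕ → ℕ, (∀ j < l, n j ≤ t) ∧ (2 ≤ l → ∃ j < l, ∃ k < l, n j ≠ n k) ∧
      ∑ j ∈ Finset.range l, ((t : ℤ) - 2 * n j) = (if Odd (l * t) then e else 0) ∧
      (2 ≤ t → ¬(l = 2 ∧ t = 2) → ∃ j < l, 0 < n j ∧ n j < t) := by
  rcases Nat.even_or_odd' t with ⟨m, rfl | rfl⟩
  · have hodd : ¬ Odd (l * (2 * m)) := by
      rw [Nat.not_odd_iff_even]
      exact (even_two_mul m).mul_left l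
    rw [if_neg hodd]
    obtain rfl | ⟨k, rfl⟩ : l = 1 ∨ ∃ k, l = k + 2 := by
      rcases l with _ | _ | k
      · omega
      · exact Or.inl rfl
      · exact Or.inr ⟨k, rfl⟩
    · exact ⟨fun _ => m, fun _ _ => by dsimp only; omega, by omega, by simp,
        fun h _ => ⟨0, by omega, by dsimp only; omega, by dsimp only; omega⟩⟩
    · refine ⟨fun j => if j = 0 then m - 1 else if j = 1 then m + 1 else m, ?_, ?_, ?_, ?_⟩
      · intro j _
        dsimp only
        split_ifs <;> omega
      · intro _
        refine ⟨0, by omega, 1, by omega, ?_⟩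
        simp only [if_true, one_ne_zero, if_false]
        omega
      · rw [Finset.sum_range_succ', Finset.sum_range_succ', Finset.sum_eq_zero]
        · have : 1 ≤ m := by omega
          simp [this]
          ring
        · intro j _
          simp
      · intro h1 h2
        by_cases hk : k = 0
        · refine ⟨0, by omega, ?_⟩
          simp only [if_true]
          omega
        · refine ⟨2, by omega, ?_⟩
          simp only [OfNat.ofNat_ne_zero, if_false, OfNat.ofNat_ne_one]
          omega
  · obtain ⟨f, f', hf, hff⟩ : ∃ f f' : ℕ, (f ≤ 1 ∧ f' + f = 1) ∧ (1 - 2 * f : ℤ) = e := by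
      rcases he with rfl | rfl
      · exact ⟨0, 1, by norm_num⟩
      · exact ⟨1, 0, by norm_num⟩
    refine ⟨fun j => if Even j then m + f else m + f', ?_, ?_, ?_, ?_⟩
    · intro j _
      dsimp only
      split_ifs <;> omega
    · intro _
      refine ⟨0, by omega, 1, by omega, ?_⟩
      simp only [Even.zero, if_true, Nat.not_even_one, if_false]
      omega
    · have h1 : ∀ j ∈ Finset.range l, (((2 * m + 1 : ℕ) : ℤ) -
          2 * ((if Even j then m + f else m + f' : ℕ) : ℤ)) = if Even j then e else -e := by
        intro j _
        split_ifs <;> push_cast <;> omega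
      rw [Finset.sum_congr rfl h1, sum_range_alternating]
      by_cases h2 : Even l <;> simp [h2, Nat.odd_mul, parity_simps]
    · intro h1 _
      refine ⟨0, by omega, ?_⟩
      simp only [Even.zero, if_true]
      omega

/-- Numbers `n j` of negative vertices in the `l` parts of size `t` for which the signs have
total `2`. -/
theorem exists_counts_sum_two {l t : ℕ} (hl : 1 ≤ l) (ht : 1 ≤ t) (heven : Even (l * t))
    (h21 : ¬(l = 2 ∧ t = 1)) (h12 : ¬(l = 1 ∧ t = 2)) :
    ∃ n : ℕ → ℕ, (∀ j < l, n j ≤ t) ∧ (2 ≤ l → ∃ j < l, ∃ k < l, n j ≠ n k) ∧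
      ∑ j ∈ Finset.range l, ((t : ℤ) - 2 * n j) = 2 ∧
      (2 ≤ t → ∃ j < l, 0 < n j ∧ n j < t) := by
  rcases Nat.even_or_odd' t with ⟨m, rfl | rfl⟩
  · refine ⟨fun j => if j = 0 then m - 1 else m, ?_, ?_, ?_, ?_⟩
    · intro j _
      dsimp only
      split_ifs <;> omega
    · intro h
      refine ⟨0, by omega, 1, by omega, ?_⟩
      simp only [if_true, one_ne_zero, if_false]
      omega
    · obtain ⟨k, rfl⟩ : ∃ k, l = k + 1 := ⟨l - 1, by omega⟩
      have : 1 ≤ m := by omega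
      rw [Finset.sum_range_succ', Finset.sum_eq_zero]
      · simp [this]
        ring
      · intro j _
        simp
    · intro _
      by_cases h1 : l = 1
      · refine ⟨0, by omega, ?_⟩
        simp only [if_true]
        omega
      · refine ⟨1, by omega, ?_⟩
        simp only [one_ne_zero, if_false]
        omega
  · have hl2 : Even l := by
      rcases Nat.even_mul.1 heven with h | h
      · exact h
      · exact absurd h (by simp)
    obtain ⟨q, hq⟩ := hl2
    obtain ⟨k, rfl⟩ : ∃ k, l = k + 2 := ⟨l - 2, by omega⟩
    have hk : Even k := ⟨q - 1, by omega⟩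
    -- The parts other than the first two have alternating sums `1` and `-1`; the first two have
    -- sums `1, 1` if `t = 1` and `3, -1` otherwise.
    have htail : ∀ (g : ℕ → ℤ), g 0 + g 1 = 2 →
        (∀ j, g (j + 1 + 1) = if Even j then 1 else -1) →
        ∑ j ∈ Finset.range (k + 2), g j = 2 := by
      intro g h0 h1
      rw [Finset.sum_range_succ', Finset.sum_range_succ',
        Finset.sum_congr rfl fun j _ => h1 j, sum_range_alternating]
      simp [hk]
      linarith
    by_cases hm : m = 0
    · subst hm
      refine ⟨fun j => if Even j ∨ j = 1 then 0 else 1, ?_, ?_, ?_, ?_⟩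
      · intro j _
        dsimp only
        split_ifs <;> omega
      · intro _
        refine ⟨0, by omega, 3, by omega, ?_⟩
        have : ¬ Even 3 := by decide
        simp [this]
      · refine htail _ ?_ ?_
        · simp
        · intro j
          by_cases hj : Even j <;> simp [Nat.even_add_one, hj]
      · omega
    · refine ⟨fun j => if j = 0 then m - 1 else if Even j then m else m + 1, ?_, ?_, ?_, ?_⟩
      · intro j _
        dsimp only
        split_ifs <;> omega
      · intro _
        refine ⟨0, by omega, 1, by omega, ?_⟩
        simp only [if_true, one_ne_zero, if_false, Nat.not_even_one]
        omega
      · refine htail _ ?_ ?_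
        · have : 1 ≤ m := by omega
          simp [this]
          ring
        · intro j
          simp [Nat.even_add_one]
          split_ifs <;> ring
      · intro _
        refine ⟨1, by omega, ?_⟩
        simp only [one_ne_zero, if_false, Nat.not_even_one]
        omega

/-! ### Choice of the switching set -/

/-- Sign sums realised class by class give a good switching: `B i` is the sum of the sign vector
over the `i`-th class of parts. Class `0` has the largest parts, so some part is non-constant as
soon as one in class `0` is. -/
theorem exists_switch_of_counts {s : ℕ} {l t : Fin (s + 1) → ℕ} (hl : ∀ i, 1 ≤ l i) (ht : ∀ i, 1 ≤ t i)
    (hanti : StrictAnti t) (hcard : 2 ≤ Fintype.card (Σ i, Fin (l i))) (B : Fin (s + 1) → ℤ)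
    (hB : ∀ i, ∃ n : ℕ → ℕ, (∀ j < l i, n j ≤ t i) ∧
      (2 ≤ l i → ∃ j < l i, ∃ k < l i, n j ≠ n k) ∧
      ∑ j ∈ Finset.range (l i), ((t i : ℤ) - 2 * n j) = B i ∧
      (i = 0 → 2 ≤ t i → ∃ j < l i, 0 < n j ∧ n j < t i))
    (hmain : ∀ x : ℝ, x ≠ 0 → (∀ i, x + t i ≠ 0) → ∑ i, (B i : ℝ) / (x + t i) ≠ 0) :
    ∃ X : Set (MultipartiteVertex l t), ∀ μ : ℝ,
      ((SignedGraph.ofGraph (multipartiteGraph l t)).switch X).IsEigenvalue μ →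
        ((SignedGraph.ofGraph (multipartiteGraph l t)).switch X).IsMainEigenvalue μ := by
  choose n hn hne hsum hzero using hB
  refine ⟨{v | (v.2 : ℕ) < n v.1.1 v.1.2}, fun μ => ?_⟩
  refine isMainEigenvalue_of_isEigenvalue (t := fun p : Σ i, Fin (l i) => t p.1) (fun p => ht p.1)
    hcard (fun p => (t p.1 : ℝ) - 2 * n p.1 p.2) ?_ ?_ ?_ ?_
  · rintro ⟨i, j⟩
    obtain ⟨r, hr⟩ := Nat.exists_eq_add_of_le (hn i j j.2)
    have hrange := Fin.sum_univ_eq_sum_range (fun k => if k < n i j then (-1 : ℝ) else 1) (t i)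
    refine (Finset.sum_congr rfl fun k _ => ?_).trans (hrange.trans ?_)
    · simp [switchingSign]
    · rw [hr, Finset.sum_range_add,
        Finset.sum_congr rfl fun k hk => if_pos (Finset.mem_range.1 hk)]
      simp
      ring
  · rintro ⟨p, hp⟩
    obtain ⟨j, hj, h0, h1⟩ := hzero 0 rfl (hp.trans (hanti.antitone (Fin.zero_le p.1)))
    refine ⟨⟨0, ⟨j, hj⟩⟩, ⟨0, ht 0⟩, ⟨n 0 j, h1⟩, ?_⟩
    simp only [switchingSign, Set.mem_ofPred_eq, h0, lt_irrefl, if_true, if_false]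
    norm_num
  · rintro ⟨i, j⟩ ⟨i', j'⟩ hpq htt
    obtain rfl : i = i' := hanti.injective htt
    have hjj : (j : ℕ) ≠ j' := fun h => hpq (by rw [Fin.ext h])
    obtain ⟨a, ha, b, hb, hab⟩ := hne i (by have := j.2; have := j'.2; omega)
    refine ⟨⟨i, ⟨a, ha⟩⟩, ⟨i, ⟨b, hb⟩⟩, rfl, rfl, fun h => hab ?_⟩
    have : (n i a : ℝ) = n i b := by
      simp only at h
      linarith
    exact_mod_cast this
  · intro x hx hxt
    have hBsum : ∀ i, (B i : ℝ) = ∑ j : Fin (l i), ((t i : ℝ) - 2 * n i j) := by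
      intro i
      rw [← hsum i, Fin.sum_univ_eq_sum_range (fun j => (t i : ℝ) - 2 * n i j) (l i)]
      push_cast
      rfl
    rw [Fintype.sum_sigma]
    have h1 : ∀ i, ∑ j : Fin (l i), ((t i : ℝ) - 2 * n i j) / (x + t i) = B i / (x + t i) := by
      intro i
      rw [hBsum, Finset.sum_div]
    simp only [h1]
    exact hmain x hx fun i => hxt ⟨i, ⟨0, hl i⟩⟩

theorem theorem4p1 (s : ℕ) (hs : 1 ≤ s) (l t : Fin s → ℕ)
    (hl : ∀ i, 1 ≤ l i) (ht : ∀ i, 1 ≤ t i) (hanti : StrictAnti t)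
    (hK2 : IsEmpty (multipartiteGraph l t ≃g (⊤ : SimpleGraph (Fin 2))))
    (hK4 : IsEmpty (multipartiteGraph l t ≃g completeFourMinusEdge)) :
    ∃ X : Set (MultipartiteVertex l t), ∀ μ : ℝ,
      ((SignedGraph.ofGraph (multipartiteGraph l t)).switch X).IsEigenvalue μ →
        ((SignedGraph.ofGraph (multipartiteGraph l t)).switch X).IsMainEigenvalue μ := by
  obtain ⟨s, rfl⟩ : ∃ s', s = s' + 1 := ⟨s - 1, by omega⟩
  by_cases hcard : 2 ≤ Fintype.card (Σ i, Fin (l i))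
  swap
  · -- A single part: the graph has no edges and `0` is its only eigenvalue.
    have hsub : Subsingleton (Σ i, Fin (l i)) :=
      Fintype.card_le_one_iff_subsingleton.1 (by omega)
    have huniv : ∀ (y : MultipartiteVertex l t → ℝ) p, ∑ u, y u - ∑ k, y ⟨p, k⟩ = 0 := by
      intro y p
      rw [Fintype.sum_sigma, Fintype.sum_subsingleton _ p, sub_self]
    refine ⟨∅, fun μ hμ => ?_⟩
    obtain ⟨y, hy0, hy⟩ :=
      exists_of_isEigenvalue_switch (t := fun p : Σ i, Fin (l i) => t p.1) hμ
    refine isMainEigenvalue_switch (t := fun p : Σ i, Fin (l i) => t p.1) (y := fun _ => 1) ?_ ?_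
    · obtain ⟨w, hw⟩ := Function.ne_iff.1 hy0
      have h1 := hy w
      rw [huniv y w.1] at h1
      have hμ0 : μ = 0 := (mul_eq_zero.1 h1.symm).resolve_right hw
      intro v
      rw [huniv (fun _ => 1) v.1, hμ0, zero_mul]
    · have : Nonempty (MultipartiteVertex l t) := ⟨⟨⟨0, ⟨0, hl 0⟩⟩, ⟨0, ht 0⟩⟩⟩
      simp only [switchingSign, Set.mem_empty_iff_false, if_false, mul_one, Finset.sum_const,
        Finset.card_univ, nsmul_eq_mul]
      exact Nat.cast_ne_zero.2 Fintype.card_ne_zero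
  have hsmall : ∀ i (e : ℤ), (e = 1 ∨ e = -1) → (i = 0 → ¬(l i = 2 ∧ t i = 2)) →
      ∃ n : ℕ → ℕ, (∀ j < l i, n j ≤ t i) ∧ (2 ≤ l i → ∃ j < l i, ∃ k < l i, n j ≠ n k) ∧
      ∑ j ∈ Finset.range (l i), ((t i : ℤ) - 2 * n j) = (if Odd (l i * t i) then e else 0) ∧
      (i = 0 → 2 ≤ t i → ∃ j < l i, 0 < n j ∧ n j < t i) := by
    intro i e he hi
    obtain ⟨n, h1, h2, h3, h4⟩ := exists_counts_sum_small (hl i) (ht i) he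
    exact ⟨n, h1, h2, h3, fun h0 ht2 => h4 ht2 (hi h0)⟩
  by_cases hodd : ∃ i, Odd (l i * t i)
  · by_cases h22 : l 0 = 2 ∧ t 0 = 2
    · -- Here the other class consists of an odd number of single vertices, and the sums `2`
      -- and `-1` leave `0` as the only root.
      obtain ⟨i, hi⟩ := hodd
      have hi0 : i ≠ 0 := by
        rintro rfl
        rw [h22.1, h22.2] at hi
        exact absurd hi (by decide)
      have ht1 : ∀ j, j ≠ 0 → t j = 1 := by
        intro j hj
        have := hanti (Fin.pos_iff_ne_zero.2 hj)
        have := ht j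
        omega
      refine exists_switch_of_counts hl ht hanti hcard
        (fun j => if j = 0 then 2 else if Odd (l j * t j) then -1 else 0) ?_ ?_
      · intro j
        by_cases hj : j = 0
        · subst hj
          obtain ⟨n, h1, h2, h3, h4⟩ := exists_counts_sum_two (hl 0) (ht 0)
            (by rw [h22.1, h22.2]; decide) (by omega) (by omega)
          exact ⟨n, h1, h2, by simpa using h3, fun _ => h4⟩
        · simpa only [if_neg hj] using hsmall j (-1) (Or.inr rfl) fun h => absurd h hj
      · intro x hx hxt
        rw [Fintype.sum_eq_add 0 i hi0.symm]
        · have h0 := hxt 0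
          have h1 := hxt i
          simp only [if_neg hi0, if_pos hi, if_true]
          rw [h22.2] at h0 ⊢
          rw [ht1 i hi0] at h1 ⊢
          push_cast at h0 h1 ⊢
          rw [div_add_div _ _ h0 h1]
          refine div_ne_zero ?_ (mul_ne_zero h0 h1)
          ring_nf
          exact hx
        · rintro j ⟨hj0, hji⟩
          exact absurd (hanti.injective ((ht1 j hj0).trans (ht1 i hi0).symm)) hji
    · obtain ⟨ε, hε, hne⟩ := exists_sign_sum_div_ne_zero (t := fun i => (t i : ℝ))
        (fun i j h => Nat.cast_lt.2 (hanti h)) (Finset.univ.filter fun i => Odd (l i * t i))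
        (by simpa [Finset.Nonempty] using hodd)
      refine exists_switch_of_counts hl ht hanti hcard
        (fun i => if Odd (l i * t i) then ε i else 0)
        (fun i => hsmall i (ε i) (hε i) fun h => h ▸ h22) fun x _ hxt => ?_
      convert hne x fun i _ => hxt i using 1
      rw [Finset.sum_filter]
      refine Finset.sum_congr rfl fun i _ => ?_
      split_ifs <;> simp
  · push Not at hodd
    by_cases hgood : ∃ i, ¬(l i = 2 ∧ t i = 1) ∧ ¬(l i = 1 ∧ t i = 2)
    · obtain ⟨i, hi1, hi2, hi0⟩ : ∃ i, ¬(l i = 2 ∧ t i = 1) ∧ ¬(l i = 1 ∧ t i = 2) ∧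
          (i ≠ 0 → ¬(l 0 = 2 ∧ t 0 = 2)) := by
        by_cases h22 : l 0 = 2 ∧ t 0 = 2
        · exact ⟨0, by omega, by omega, fun h => absurd rfl h⟩
        · obtain ⟨i, h1, h2⟩ := hgood
          exact ⟨i, h1, h2, fun _ => h22⟩
      refine exists_switch_of_counts hl ht hanti hcard (fun j => if j = i then 2 else 0) ?_ ?_
      · intro j
        by_cases hj : j = i
        · subst hj
          obtain ⟨n, h1, h2, h3, h4⟩ := exists_counts_sum_two (hl j) (ht j)
            (Nat.not_odd_iff_even.1 (hodd j)) hi1 hi2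
          exact ⟨n, h1, h2, by simpa using h3, fun _ => h4⟩
        · simpa only [if_neg hj, if_neg (hodd j)] using
            hsmall j 1 (Or.inl rfl) fun h => h ▸ hi0 fun h' => hj (h.trans h'.symm)
      · intro x _ hxt
        rw [Fintype.sum_eq_single i fun j hj => by simp [hj]]
        simpa using hxt i
    · push Not at hgood
      exfalso
      have hcases : ∀ i, (l i = 2 ∧ t i = 1) ∨ (l i = 1 ∧ t i = 2) := by
        intro i
        by_contra h
        have := hgood i
        tauto
      -- Sizes in different classes differ, so at most two classes are left; they give `K₂`, a
      -- single part, or `K₄ - e`.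
      rcases s with _ | _ | s
      · rcases hcases 0 with h | h
        · obtain rfl : l = fun _ => 2 := funext fun i => by rw [Fin.fin_one_eq_zero i, h.1]
          obtain rfl : t = fun _ => 1 := funext fun i => by rw [Fin.fin_one_eq_zero i, h.2]
          refine hK2.false ⟨Equiv.ofBijective (fun v => v.1.2) ?_, ?_⟩
          · decide
          · decide
        · simp [h.1] at hcard
      · have h01 : t 1 < t 0 := hanti (by decide)
        have h0 := hcases 0
        have h1 := hcases 1
        obtain rfl : l = ![1, 2] := by
          funext i
          fin_cases i <;> simp <;> omega
        obtain rfl : t = ![2, 1] := by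
          funext i
          fin_cases i <;> simp <;> omega
        refine hK4.false ⟨Equiv.ofBijective
          (fun v => if v.1.1 = 0 then Fin.ofNat 4 v.2 else Fin.ofNat 4 (2 + v.1.2)) ?_, ?_⟩
        · decide
        · simp only [completeFourMinusEdge, SimpleGraph.deleteEdges_adj, Equiv.ofBijective_apply,
            SimpleGraph.comap_adj, SimpleGraph.top_adj, Set.mem_singleton_iff]
          decide
      · have h01 : t ⟨1, by omega⟩ < t ⟨0, by omega⟩ := hanti (by simp)
        have h12 : t ⟨2, by omega⟩ < t ⟨1, by omega⟩ := hanti (by rw [Fin.lt_def]; norm_num)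
        have h0 := hcases ⟨0, by omega⟩
        have h2 := hcases ⟨2, by omega⟩
        omega
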